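/- Let $n\ge 3$ be an integer, $0<m<\frac{n-2}{n}$, $\beta<0$ and $\alpha=\frac{2\beta}{1-m}$. Then for every constant $A>0$ there exists a unique positive function $f\in C^2((0,\infty))$ satisfying $$\frac{n-1}{m}\left((f^m)_{rr}+\frac{n-1}{r}(f^m)_r\right)+\alpha f+\beta r f_r=0\qquad\text{for all } r>0$$ and $$\lim_{r\to\infty} r^{\frac{n-2}{m}}f(r)=A.$$ Moreover, this $f$ satisfies $$\lim_{r\to 0^+}\frac{r^2 f(r)^{1-m}}{\log (1/r)}=\frac{2(n-1)(n-2-nm)}{(1-m)|\beta|}$$ and $$\alpha f(r)+\beta r f_r(r)>0\qquad\text{for all } r>0.$$ -/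

import Mathlib

open Set Filter Topology

/-- `f` is a classical (twice continuously differentiable) positive solution on `(0, ∞)` of
`(n-1)/m * ((f^m)_rr + (n-1)/r * (f^m)_r) + α f + β r f_r = 0`.
Only the values of `f` on `(0, ∞)` matter; since `(0, ∞)` is open and `f` is `C²` and positive
there, all the derivatives below are genuine. -/
structure IsProfile (n : ℕ) (m α β : ℝ) (f : ℝ → ℝ) : Prop where
  contDiffOn : ContDiffOn ℝ 2 f (Ioi 0)
  pos : ∀ r : ℝ, 0 < r → 0 < f r
  ode : ∀ r : ℝ, 0 < r →
    ((n : ℝ) - 1) / m *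
        (deriv (deriv (fun s : ℝ => f s ^ m)) r
          + ((n : ℝ) - 1) / r * deriv (fun s : ℝ => f s ^ m) r)
      + α * f r + β * r * deriv f r = 0

/-- `lim_{r → ∞} r^((n-2)/m) f(r) = A`. -/
def HasDecay (n : ℕ) (m A : ℝ) (f : ℝ → ℝ) : Prop :=
  Tendsto (fun r : ℝ => r ^ (((n : ℝ) - 2) / m) * f r) atTop (𝓝 A)

/-!
In the variable `s = log r`, with `T = log (r ^ 2 * f ^ (1 - m))` and `ς = -T' / q`, where
`q = (1 - m) / m`, the profile equation becomes autonomous: `T' = -q ς`,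
`ς' = (ς - k) (ς + a) + b e ^ T ς`, with `a = 2 m / (1 - m)`, `k = n - 2 - a > 0` and
`b = |β| / (n - 1)` (`profile_ode_iff`). The decay condition says that `k s + T / q → m log A`
as `s → ∞` (`hasDecay_iff`), and `α f + β r f'` is a positive multiple of `ς`.

Taking `x = e ^ T` as independent variable, `ς = σ x` solves the scalar equation
`q x σ' = -(σ - (k - a) - a k / σ + b x)`, whose right-hand side is decreasing in `σ > 0`; the
constant `k` is a supersolution and `k / (1 + (b / a) x)` a subsolution. The equation is singular at
`x = 0`. With an integrating factor it turns into a fixed-point equation for an order-preserving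
integral operator, and the iterates started at `k` decrease to a solution `σ` (`exists_isSlope`).

Existence: integrating `ds = -dT / (q σ)` gives a decreasing bijection of `ℝ`, the `clock`, which is
normalized at `T = -∞`; its inverse is the orbit sought. Since `x σ x → a k / b` as `x → ∞`
(`IsSlope.tendsto_mul_self`), `e ^ T` grows linearly in `-s` at the rate `q a k / b`, and this is the
logarithmic behaviour of `f` at the origin (`exists_isOrbit`).

Uniqueness: the decay condition alone forces `0 < ς < k` (`IsOrbit.pos`, `IsOrbit.lt`). The
deviation `R = ς - σ(e ^ T)` of any such orbit from the graph of `σ` satisfies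
`R' = (ς + a k / σ) R`, so it would grow exponentially if it were not zero, although it is bounded
(`IsOrbit.eq_slope`). So every such orbit is read off the same clock, and the decay condition fixes
the remaining translation in `s` (`IsOrbit.unique`).
-/

/-! ### The slope function: an integral equation solved by monotone iteration -/

/-- `σ` is a slope function: a solution of `q x σ' = -(σ - (k - a) - a k / σ + b x)` on `(0, ∞)`
pinched between `k / (1 + (b / a) x)` and `k`, so that `σ (0+) = k`. It is extended by the constant
`k` to `(-∞, 0]`, which makes every integral starting at `0` an integral of a globally measurable
function. -/
structure IsSlope (a k q b : ℝ) (σ : ℝ → ℝ) : Prop where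
  measurable : Measurable σ
  eq_of_nonpos : ∀ x ≤ 0, σ x = k
  lower : ∀ x > 0, k / (1 + b / a * x) ≤ σ x
  upper : ∀ x > 0, σ x ≤ k
  hasDerivAt : ∀ x > 0,
    HasDerivAt σ (-(σ x - (k - a) - a * k / σ x + b * x) / (q * x)) x

namespace Slope

/-- The relaxation rate `λ(y)`. It dominates the `s`-derivative of
`(s - (k - a) - a k / s + b y) / q` for all `s ≥ k / (1 + (b / a) y)`, once `ν` is large. -/
noncomputable def rate (a k q b : ℝ) (ν : ℕ) (y : ℝ) : ℝ :=
  (ν + 1) + 2 * b / (k * q) * y + b ^ 2 / (a * k * q) * y ^ 2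

/-- The integrating factor `M` of `y σ' + λ(y) σ`, divided by `y`. -/
noncomputable def density (a k q b : ℝ) (ν : ℕ) (y : ℝ) : ℝ :=
  y ^ ν * Real.exp (2 * b / (k * q) * y + b ^ 2 / (2 * a * k * q) * y ^ 2)

/-- The integrating factor `M` of `y σ' + λ(y) σ`, that is, `y M' = λ M`. -/
noncomputable def factor (a k q b : ℝ) (ν : ℕ) (y : ℝ) : ℝ := y * density a k q b ν y

/-- The right-hand side `λ(y) s - (s - (k - a) - a k / s + b y) / q` of the relaxed equation
`y σ' + λ(y) σ = rhs y σ`. -/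
noncomputable def rhs (a k q b : ℝ) (ν : ℕ) (y s : ℝ) : ℝ :=
  rate a k q b ν y * s - (s - (k - a) - a * k / s + b * y) / q

/-- The solution operator of the relaxed equation, with the right-hand side frozen at `σ`. -/
noncomputable def step (a k q b : ℝ) (ν : ℕ) (σ : ℝ → ℝ) (x : ℝ) : ℝ :=
  if x ≤ 0 then k
  else (∫ y in (0 : ℝ)..x, density a k q b ν y * rhs a k q b ν y (σ y)) / factor a k q b ν x

/-- The order interval on which the iteration takes place. -/
structure Admissible (a k b : ℝ) (σ : ℝ → ℝ) : Prop where
  measurable : Measurable σ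
  eq_of_nonpos : ∀ x ≤ 0, σ x = k
  lower : ∀ x > 0, k / (1 + b / a * x) ≤ σ x
  upper : ∀ x > 0, σ x ≤ k

variable {a k q b : ℝ} {ν : ℕ}

lemma continuous_rate : Continuous (rate a k q b ν) := by unfold rate; fun_prop

lemma continuous_density : Continuous (density a k q b ν) := by unfold density; fun_prop

lemma density_pos {y : ℝ} (hy : 0 < y) : 0 < density a k q b ν y := by unfold density; positivity

lemma factor_pos {y : ℝ} (hy : 0 < y) : 0 < factor a k q b ν y := mul_pos hy (density_pos hy)

lemma rate_pos (ha : 0 < a) (hk : 0 < k) (hq : 0 < q) (hb : 0 < b) {y : ℝ} (hy : 0 < y) :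
    0 < rate a k q b ν y := by unfold rate; positivity

lemma hasDerivAt_factor (ha : 0 < a) (hk : 0 < k) (hq : 0 < q) (y : ℝ) :
    HasDerivAt (factor a k q b ν) (density a k q b ν y * rate a k q b ν y) y := by
  have h1 : HasDerivAt (fun y : ℝ => 2 * b / (k * q) * y + b ^ 2 / (2 * a * k * q) * y ^ 2)
      (2 * b / (k * q) + b ^ 2 / (a * k * q) * y) y := by
    refine (((hasDerivAt_id y).const_mul (2 * b / (k * q))).add
      ((hasDerivAt_pow 2 y).const_mul (b ^ 2 / (2 * a * k * q)))).congr_deriv ?_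
    field_simp
    ring
  have h2 := (hasDerivAt_pow (ν + 1) y).mul h1.exp
  have e : factor a k q b ν = fun y : ℝ => y ^ (ν + 1) *
      Real.exp (2 * b / (k * q) * y + b ^ 2 / (2 * a * k * q) * y ^ 2) := by
    funext y; simp only [factor, density]; ring
  rw [e]
  refine h2.congr_deriv ?_
  simp only [density, rate]
  push_cast
  ring

lemma integral_density_mul_rate (ha : 0 < a) (hk : 0 < k) (hq : 0 < q) (x : ℝ) :
    ∫ y in (0 : ℝ)..x, density a k q b ν y * rate a k q b ν y = factor a k q b ν x := by
  rw [intervalIntegral.integral_eq_sub_of_hasDerivAt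
    (fun y _ => hasDerivAt_factor ha hk hq y)
    ((continuous_density.mul continuous_rate).intervalIntegrable _ _)]
  simp [factor]

lemma lower_pos (ha : 0 < a) (hk : 0 < k) (hb : 0 < b) {y : ℝ} (hy : 0 < y) :
    0 < k / (1 + b / a * y) := by positivity

lemma rhs_mono (ha : 0 < a) (hk : 0 < k) (hq : 0 < q) (hb : 0 < b)
    (hν : (1 + a / k) / q ≤ ν + 1) {y s t : ℝ} (hy : 0 < y)
    (hs : k / (1 + b / a * y) ≤ s) (hst : s ≤ t) :
    rhs a k q b ν y s ≤ rhs a k q b ν y t := by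
  have hl := lower_pos ha hk hb hy
  have hs0 : 0 < s := hl.trans_le hs
  have ht0 : 0 < t := hs0.trans_le hst
  have h1 : a * k / (s * t) ≤ a / k * (1 + b / a * y) ^ 2 := by
    have h2 : (k / (1 + b / a * y)) * (k / (1 + b / a * y)) ≤ s * t :=
      mul_le_mul hs (hs.trans hst) hl.le hs0.le
    calc a * k / (s * t) ≤ a * k / ((k / (1 + b / a * y)) * (k / (1 + b / a * y))) :=
          div_le_div_of_nonneg_left (by positivity) (by positivity) h2
      _ = a / k * (1 + b / a * y) ^ 2 := by field_simp
  have h3 : (1 + a * k / (s * t)) / q ≤ rate a k q b ν y := by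
    calc (1 + a * k / (s * t)) / q ≤ (1 + a / k * (1 + b / a * y) ^ 2) / q := by gcongr
      _ = (1 + a / k) / q + 2 * b / (k * q) * y + b ^ 2 / (a * k * q) * y ^ 2 := by
          field_simp; ring
      _ ≤ rate a k q b ν y := by unfold rate; gcongr
  have h4 : rhs a k q b ν y t - rhs a k q b ν y s
      = (t - s) * (rate a k q b ν y - (1 + a * k / (s * t)) / q) := by
    unfold rhs; field_simp; ring
  have h5 := mul_nonneg (sub_nonneg.2 hst) (sub_nonneg.2 h3)
  linarith

lemma rhs_top_le (hk : 0 < k) (hq : 0 < q) (hb : 0 < b) {y : ℝ} (hy : 0 < y) :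
    rhs a k q b ν y k ≤ rate a k q b ν y * k := by
  have : rhs a k q b ν y k = rate a k q b ν y * k - b * y / q := by
    unfold rhs; field_simp; ring
  rw [this]
  have : 0 < b * y / q := by positivity
  linarith

lemma le_rhs_lower (ha : 0 < a) (hk : 0 < k) (hq : 0 < q) (hb : 0 < b) {y : ℝ} (hy : 0 < y) :
    rate a k q b ν y * (k / (1 + b / a * y)) ≤ rhs a k q b ν y (k / (1 + b / a * y)) := by
  have e : rhs a k q b ν y (k / (1 + b / a * y)) = rate a k q b ν y * (k / (1 + b / a * y))
      + k * (b / a * y) / (1 + b / a * y) / q := by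
    unfold rhs; field_simp; ring
  rw [e]
  have : 0 < k * (b / a * y) / (1 + b / a * y) / q := by positivity
  linarith

namespace Admissible

variable {σ τ : ℝ → ℝ}

lemma pos (h : Admissible a k b σ) (ha : 0 < a) (hk : 0 < k) (hb : 0 < b) (x : ℝ) :
    0 < σ x := by
  rcases le_or_gt x 0 with hx | hx
  · rwa [h.eq_of_nonpos x hx]
  · exact (lower_pos ha hk hb hx).trans_le (h.lower x hx)

lemma measurable_rhs (h : Admissible a k b σ) :
    Measurable (fun y => density a k q b ν y * rhs a k q b ν y (σ y)) := by
  have := h.measurable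
  have h1 := (continuous_density (a := a) (k := k) (q := q) (b := b) (ν := ν)).measurable
  have h2 := (continuous_rate (a := a) (k := k) (q := q) (b := b) (ν := ν)).measurable
  unfold rhs
  fun_prop

lemma rhs_le (h : Admissible a k b σ) (ha : 0 < a) (hk : 0 < k) (hq : 0 < q) (hb : 0 < b)
    (hν : (1 + a / k) / q ≤ ν + 1) {y : ℝ} (hy : 0 < y) :
    rhs a k q b ν y (σ y) ≤ rate a k q b ν y * k :=
  (rhs_mono ha hk hq hb hν hy (h.lower y hy) (h.upper y hy)).trans (rhs_top_le hk hq hb hy)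

lemma le_rhs (h : Admissible a k b σ) (ha : 0 < a) (hk : 0 < k) (hq : 0 < q) (hb : 0 < b)
    (hν : (1 + a / k) / q ≤ ν + 1) {y : ℝ} (hy : 0 < y) :
    rate a k q b ν y * (k / (1 + b / a * y)) ≤ rhs a k q b ν y (σ y) :=
  (le_rhs_lower ha hk hq hb hy).trans (rhs_mono ha hk hq hb hν hy le_rfl (h.lower y hy))

lemma norm_rhs_le (h : Admissible a k b σ) (ha : 0 < a) (hk : 0 < k) (hq : 0 < q) (hb : 0 < b)
    (hν : (1 + a / k) / q ≤ ν + 1) (y : ℝ) :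
    ‖density a k q b ν y * rhs a k q b ν y (σ y)‖
      ≤ |density a k q b ν y| * (|rate a k q b ν y| * k + b * |y| / q) := by
  rw [Real.norm_eq_abs, abs_mul]
  refine mul_le_mul_of_nonneg_left ?_ (abs_nonneg _)
  rcases le_or_gt y 0 with hy | hy
  · rw [h.eq_of_nonpos y hy]
    have e : rhs a k q b ν y k = rate a k q b ν y * k - b * y / q := by
      unfold rhs; field_simp; ring
    rw [e]
    refine (abs_sub _ _).trans (le_of_eq ?_)
    rw [abs_mul, abs_div, abs_mul, abs_of_pos hk, abs_of_pos hb, abs_of_pos hq]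
  · have h1 := h.le_rhs ha hk hq hb hν hy
    have h2 := h.rhs_le ha hk hq hb hν hy
    have h3 := rate_pos (ν := ν) ha hk hq hb hy
    have h4 : 0 < rate a k q b ν y * (k / (1 + b / a * y)) := by positivity
    rw [abs_of_nonneg (h4.le.trans h1), abs_of_pos h3]
    have : 0 ≤ b * |y| / q := by positivity
    linarith

lemma continuous_bound :
    Continuous (fun y => |density a k q b ν y| * (|rate a k q b ν y| * k + b * |y| / q)) := by
  have h1 := continuous_density (a := a) (k := k) (q := q) (b := b) (ν := ν)
  have h2 := continuous_rate (a := a) (k := k) (q := q) (b := b) (ν := ν)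
  fun_prop

lemma intervalIntegrable (h : Admissible a k b σ) (ha : 0 < a) (hk : 0 < k) (hq : 0 < q)
    (hb : 0 < b) (hν : (1 + a / k) / q ≤ ν + 1) (x z : ℝ) :
    IntervalIntegrable (fun y => density a k q b ν y * rhs a k q b ν y (σ y))
      MeasureTheory.volume x z :=
  (continuous_bound.intervalIntegrable x z).mono_fun h.measurable_rhs.aestronglyMeasurable
    (Eventually.of_forall fun y => (h.norm_rhs_le ha hk hq hb hν y).trans (le_abs_self _))

lemma step_admissible (h : Admissible a k b σ) (ha : 0 < a) (hk : 0 < k) (hq : 0 < q)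
    (hb : 0 < b) (hν : (1 + a / k) / q ≤ ν + 1) : Admissible a k b (step a k q b ν σ) where
  measurable := by
    have h1 : Measurable (fun x => ∫ y in (0 : ℝ)..x,
        density a k q b ν y * rhs a k q b ν y (σ y)) :=
      (intervalIntegral.continuous_primitive
        (fun x z => h.intervalIntegrable ha hk hq hb hν x z) 0).measurable
    have h2 : Measurable (factor a k q b ν) := by
      have := (continuous_density (a := a) (k := k) (q := q) (b := b) (ν := ν)).measurable
      unfold factor; fun_prop
    exact Measurable.ite measurableSet_Iic measurable_const (h1.div h2)
  eq_of_nonpos := fun x hx => by simp [step, hx]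
  lower := fun x hx => by
    simp only [step, not_le.2 hx, if_false]
    rw [le_div_iff₀ (factor_pos hx), ← integral_density_mul_rate ha hk hq,
      ← intervalIntegral.integral_const_mul]
    refine intervalIntegral.integral_mono_on_of_le_Ioo hx.le
      (((continuous_density.mul continuous_rate).intervalIntegrable _ _).const_mul _)
      (h.intervalIntegrable ha hk hq hb hν 0 x) fun y hy => ?_
    have hd := density_pos (a := a) (k := k) (q := q) (b := b) (ν := ν) hy.1
    have hr := rate_pos (ν := ν) ha hk hq hb hy.1
    have h1 := h.le_rhs ha hk hq hb hν hy.1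
    have hy0 := hy.1
    have h2 : k / (1 + b / a * x) ≤ k / (1 + b / a * y) := by
      have := hy.2.le
      gcongr
    calc k / (1 + b / a * x) * (density a k q b ν y * rate a k q b ν y)
        ≤ k / (1 + b / a * y) * (density a k q b ν y * rate a k q b ν y) := by gcongr
      _ = density a k q b ν y * (rate a k q b ν y * (k / (1 + b / a * y))) := by ring
      _ ≤ _ := by gcongr
  upper := fun x hx => by
    simp only [step, not_le.2 hx, if_false]
    rw [div_le_iff₀ (factor_pos hx), ← integral_density_mul_rate ha hk hq,
      ← intervalIntegral.integral_const_mul]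
    refine intervalIntegral.integral_mono_on_of_le_Ioo hx.le
      (h.intervalIntegrable ha hk hq hb hν 0 x)
      (((continuous_density.mul continuous_rate).intervalIntegrable _ _).const_mul _)
      fun y hy => ?_
    have hd := density_pos (a := a) (k := k) (q := q) (b := b) (ν := ν) hy.1
    have h1 := h.rhs_le ha hk hq hb hν hy.1
    calc _ ≤ density a k q b ν y * (rate a k q b ν y * k) := by gcongr
      _ = _ := by ring

lemma step_mono (hσ : Admissible a k b σ) (hτ : Admissible a k b τ) (ha : 0 < a) (hk : 0 < k)
    (hq : 0 < q) (hb : 0 < b) (hν : (1 + a / k) / q ≤ ν + 1) (hle : ∀ x, σ x ≤ τ x) (x : ℝ) :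
    step a k q b ν σ x ≤ step a k q b ν τ x := by
  rcases le_or_gt x 0 with hx | hx
  · simp [step, hx]
  · simp only [step, not_le.2 hx, if_false]
    refine div_le_div_of_nonneg_right ?_ (factor_pos hx).le
    refine intervalIntegral.integral_mono_on_of_le_Ioo hx.le
      (hσ.intervalIntegrable ha hk hq hb hν 0 x) (hτ.intervalIntegrable ha hk hq hb hν 0 x)
      fun y hy => ?_
    exact mul_le_mul_of_nonneg_left
      (rhs_mono ha hk hq hb hν hy.1 (hσ.lower y hy.1) (hle y)) (density_pos hy.1).le

end Admissible

lemma admissible_const (ha : 0 < a) (hk : 0 < k) (hb : 0 < b) :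
    Admissible a k b (fun _ => k) where
  measurable := measurable_const
  eq_of_nonpos := fun _ _ => rfl
  lower := fun x hx => div_le_self hk.le (by have : 0 < b / a * x := by positivity
                                             linarith)
  upper := fun _ _ => le_rfl

/-- The decreasing iterates of `step` started at the supersolution `k` converge to a fixed
point. -/
lemma exists_step_eq (ha : 0 < a) (hk : 0 < k) (hq : 0 < q) (hb : 0 < b)
    (hν : (1 + a / k) / q ≤ ν + 1) :
    ∃ σ, Admissible a k b σ ∧ step a k q b ν σ = σ := by
  set u : ℕ → ℝ → ℝ := fun i => (step a k q b ν)^[i] (fun _ => k) with hu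
  have hsucc : ∀ i, u (i + 1) = step a k q b ν (u i) := fun i =>
    Function.iterate_succ_apply' _ _ _
  have hadm : ∀ i, Admissible a k b (u i) := by
    intro i
    induction i with
    | zero => exact admissible_const ha hk hb
    | succ i ih => rw [hsucc]; exact ih.step_admissible ha hk hq hb hν
  have hanti : ∀ i x, u (i + 1) x ≤ u i x := by
    intro i
    induction i with
    | zero =>
      intro x
      rcases le_or_gt x 0 with hx | hx
      · rw [(hadm _).eq_of_nonpos x hx, (hadm _).eq_of_nonpos x hx]
      · exact (hadm 1).upper x hx
    | succ i ih =>
      intro x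
      rw [hsucc (i + 1), hsucc i]
      exact (hsucc i ▸ hadm (i + 1)).step_mono (hadm i) ha hk hq hb hν
        (fun x => by rw [← hsucc]; exact ih x) x
  have hlim : ∀ x, Tendsto (fun i => u i x) atTop (𝓝 (⨅ i, u i x)) := fun x =>
    tendsto_atTop_ciInf (antitone_nat_of_succ_le fun i => hanti i x)
      ⟨0, by rintro _ ⟨i, rfl⟩; exact ((hadm i).pos ha hk hb x).le⟩
  set σ : ℝ → ℝ := fun x => ⨅ i, u i x with hσ
  have hσadm : Admissible a k b σ :=
    { measurable := measurable_of_tendsto_metrizable (fun i => (hadm i).measurable)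
        (tendsto_pi_nhds.2 hlim)
      eq_of_nonpos := fun x hx => tendsto_nhds_unique (hlim x)
        (tendsto_const_nhds.congr fun i => ((hadm i).eq_of_nonpos x hx).symm)
      lower := fun x hx => ge_of_tendsto' (hlim x) fun i => (hadm i).lower x hx
      upper := fun x hx => le_of_tendsto' (hlim x) fun i => (hadm i).upper x hx }
  refine ⟨σ, hσadm, funext fun x => ?_⟩
  refine tendsto_nhds_unique ?_ ((tendsto_add_atTop_iff_nat 1).2 (hlim x))
  simp_rw [hsucc]
  rcases le_or_gt x 0 with hx | hx
  · simp only [step, hx, if_true]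
    exact tendsto_const_nhds
  · simp only [step, not_le.2 hx, if_false]
    refine Tendsto.div_const ?_ _
    refine intervalIntegral.tendsto_integral_filter_of_dominated_convergence _
      (Eventually.of_forall fun i => (hadm i).measurable_rhs.aestronglyMeasurable)
      (Eventually.of_forall fun i => Eventually.of_forall fun y _ =>
        (hadm i).norm_rhs_le ha hk hq hb hν y)
      (Admissible.continuous_bound.intervalIntegrable _ _)
      (Eventually.of_forall fun y _ => ?_)
    have h0 := (hσadm.pos ha hk hb y).ne'
    refine Tendsto.const_mul _ ?_
    unfold rhs
    exact ((hlim y).const_mul _).sub (((((hlim y).sub_const _).sub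
      (tendsto_const_nhds.div (hlim y) h0)).add_const _).div_const _)

end Slope

theorem exists_isSlope {a k q b : ℝ} (ha : 0 < a) (hk : 0 < k) (hq : 0 < q) (hb : 0 < b) :
    ∃ σ, IsSlope a k q b σ := by
  obtain ⟨ν, hν'⟩ := exists_nat_ge ((1 + a / k) / q)
  have hν : (1 + a / k) / q ≤ ν + 1 := by linarith
  obtain ⟨σ, hσ, hfix⟩ := Slope.exists_step_eq (ν := ν) ha hk hq hb hν
  set h : ℝ → ℝ := fun y => Slope.density a k q b ν y * Slope.rhs a k q b ν y (σ y) with hh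
  set I : ℝ → ℝ := fun x => ∫ y in (0 : ℝ)..x, h y with hI
  have hrep : ∀ x > 0, σ x = I x / Slope.factor a k q b ν x := fun x hx => by
    conv_lhs => rw [← hfix]
    simp only [Slope.step, not_le.2 hx, if_false, hI, hh]
  have hint := fun x z => hσ.intervalIntegrable (ν := ν) ha hk hq hb hν x z
  have hev : ∀ x > 0, σ =ᶠ[𝓝 x] fun x => I x / Slope.factor a k q b ν x := fun x hx =>
    (eventually_gt_nhds hx).mono fun z hz => hrep z hz
  have hcont : ∀ x > 0, ContinuousAt σ x := fun x hx =>
    (((intervalIntegral.continuous_primitive hint 0).continuousAt).div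
      (Slope.hasDerivAt_factor ha hk hq x).continuousAt (Slope.factor_pos hx).ne').congr
      (hev x hx).symm
  refine ⟨σ, hσ.measurable, hσ.eq_of_nonpos, hσ.lower, hσ.upper, fun x hx => ?_⟩
  have hpos := hσ.pos ha hk hb x
  have hhc : ContinuousAt h x := by
    have h1 := (Slope.continuous_density (a := a) (k := k) (q := q) (b := b) (ν := ν)).continuousAt
      (x := x)
    have h2 := (Slope.continuous_rate (a := a) (k := k) (q := q) (b := b) (ν := ν)).continuousAt
      (x := x)
    have h3 := hcont x hx
    have h4 : ContinuousAt (fun y => a * k / σ y) x := continuousAt_const.div h3 hpos.ne'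
    simp only [hh, Slope.rhs]
    fun_prop
  have hder : HasDerivAt I (h x) x :=
    intervalIntegral.integral_hasDerivAt_right (hint 0 x)
      (hσ.measurable_rhs.stronglyMeasurable.stronglyMeasurableAtFilter) hhc
  have hd := Slope.density_pos (a := a) (k := k) (q := q) (b := b) (ν := ν) hx
  have hM := Slope.factor_pos (a := a) (k := k) (q := q) (b := b) (ν := ν) hx
  refine ((hder.div (Slope.hasDerivAt_factor ha hk hq x) hM.ne').congr_of_eventuallyEq
    (hev x hx)).congr_deriv ?_
  have hIx : I x = σ x * Slope.factor a k q b ν x := by rw [hrep x hx]; field_simp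
  rw [hIx]
  simp only [hh, Slope.rhs, Slope.factor]
  field_simp
  ring

/-! ### Differential inequalities on half-lines -/

lemma sub_le_of_deriv_le_on_Ici {φ φ' : ℝ → ℝ} {x₀ C : ℝ}
    (hφ : ∀ x ≥ x₀, HasDerivAt φ (φ' x) x) (hC : ∀ x ≥ x₀, φ' x ≤ C) {x : ℝ} (hx : x₀ ≤ x) :
    φ x - φ x₀ ≤ C * (x - x₀) := by
  refine (convex_Ici x₀).image_sub_le_mul_sub_of_deriv_le
    (fun y hy => (hφ y hy).continuousAt.continuousWithinAt)
    (fun y hy => (hφ y (interior_subset hy)).differentiableAt.differentiableWithinAt)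
    (fun y hy => ?_) x₀ self_mem_Ici x hx hx
  rw [(hφ y (interior_subset hy)).deriv]
  exact hC y (interior_subset hy)

lemma le_const_of_deriv_neg_at_const {φ φ' : ℝ → ℝ} {x₀ c : ℝ}
    (hφ : ∀ x ≥ x₀, HasDerivAt φ (φ' x) x) (h₀ : φ x₀ ≤ c)
    (hc : ∀ x ≥ x₀, φ x = c → φ' x < 0) {x : ℝ} (hx : x₀ ≤ x) : φ x ≤ c :=
  image_le_of_deriv_right_lt_deriv_boundary (f' := φ') (B := fun _ => c) (B' := fun _ => 0)
    (fun y hy => (hφ y hy.1).continuousAt.continuousWithinAt)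
    (fun y hy => (hφ y hy.1).hasDerivWithinAt) h₀ (fun y => hasDerivAt_const y c)
    (fun y hy => hc y hy.1) (right_mem_Icc.2 hx)

/-- A function which decreases at unit speed as long as it is above `c` is eventually below
`c`. -/
lemma eventually_le_of_deriv_le_neg_one {φ φ' : ℝ → ℝ} {x₀ c : ℝ}
    (hφ : ∀ x ≥ x₀, HasDerivAt φ (φ' x) x) (hc : ∀ x ≥ x₀, c ≤ φ x → φ' x ≤ -1) :
    ∀ᶠ x in atTop, φ x ≤ c := by
  obtain ⟨x₁, hx₁, hle⟩ : ∃ x₁ ≥ x₀, φ x₁ ≤ c := by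
    by_contra! hcon
    have h0 := hcon x₀ le_rfl
    have hx : x₀ ≤ x₀ + (φ x₀ - c) := by linarith
    have h1 := sub_le_of_deriv_le_on_Ici hφ (fun x hx => hc x hx (hcon x hx).le) hx
    have h2 := hcon _ hx
    linarith
  filter_upwards [eventually_ge_atTop x₁] with x hx
  refine le_const_of_deriv_neg_at_const (fun y hy => hφ y (hx₁.le.trans hy)) hle
    (fun y hy he => ?_) hx
  linarith [hc y (hx₁.le.trans hy) he.ge]

/-- L'Hôpital's rule for `φ x / x` at infinity. -/
lemma tendsto_div_self_of_tendsto_deriv {φ φ' : ℝ → ℝ} {L : ℝ}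
    (hφ : ∀ x > 0, HasDerivAt φ (φ' x) x) (hL : Tendsto φ' atTop (𝓝 L)) :
    Tendsto (fun x => φ x / x) atTop (𝓝 L) := by
  rw [Metric.tendsto_atTop]
  intro ε hε
  obtain ⟨x₁, hx₁⟩ := (Metric.tendsto_atTop.1 hL) (ε / 2) (half_pos hε)
  set x₀ := max x₁ 1 with hx₀
  have hx₀1 : 1 ≤ x₀ := le_max_right _ _
  have hd : ∀ x ≥ x₀, HasDerivAt φ (φ' x) x := fun x hx => hφ x (by linarith)
  have hb : ∀ x ≥ x₀, |φ' x - L| < ε / 2 := fun x hx => hx₁ x ((le_max_left _ _).trans hx)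
  refine ⟨x₀ + 2 * |φ x₀ - L * x₀| / ε + 1, fun x hx => ?_⟩
  have hnn : 0 ≤ 2 * |φ x₀ - L * x₀| / ε := by positivity
  have hx0 : x₀ ≤ x := by linarith
  have hxpos : 0 < x := by linarith
  have h1 := sub_le_of_deriv_le_on_Ici hd (C := L + ε / 2)
    (fun y hy => by linarith [(abs_lt.1 (hb y hy)).2]) hx0
  have h2 := sub_le_of_deriv_le_on_Ici (fun y hy => (hd y hy).neg) (C := -L + ε / 2)
    (fun y hy => by linarith [(abs_lt.1 (hb y hy)).1]) hx0
  simp only [Pi.neg_apply] at h2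
  have h3 : 2 * |φ x₀ - L * x₀| < ε * x := by
    have h4 : 2 * |φ x₀ - L * x₀| / ε < x := by linarith
    rw [div_lt_iff₀ hε] at h4
    linarith
  have h5 := neg_abs_le (φ x₀ - L * x₀)
  have h6 := le_abs_self (φ x₀ - L * x₀)
  have h7 : 0 < ε * x₀ := by positivity
  rw [Real.dist_eq, show φ x / x - L = (φ x - L * x) / x by field_simp, abs_div,
    abs_of_pos hxpos, div_lt_iff₀ hxpos, abs_lt]
  constructor <;> linarith

/-! ### Decay of the slope function and the associated clock -/

namespace IsSlope

variable {a k q b : ℝ} {σ : ℝ → ℝ}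

lemma pos (h : IsSlope a k q b σ) (ha : 0 < a) (hk : 0 < k) (hb : 0 < b) (x : ℝ) : 0 < σ x := by
  rcases le_or_gt x 0 with hx | hx
  · rwa [h.eq_of_nonpos x hx]
  · exact lt_of_lt_of_le (by positivity) (h.lower x hx)

lemma tendsto_mul_self (h : IsSlope a k q b σ) (ha : 0 < a) (hk : 0 < k) (hq : 0 < q)
    (hb : 0 < b) : Tendsto (fun x => x * σ x) atTop (𝓝 (a * k / b)) := by
  have hσ := h.pos ha hk hb
  have hder : ∀ x > 0, HasDerivAt (fun x => x * σ x)
      (σ x - (σ x - (k - a) - a * k / σ x + b * x) / q) x := fun x hx => by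
    refine ((hasDerivAt_id x).mul (h.hasDerivAt x hx)).congr_deriv ?_
    simp only [id]
    field_simp
    ring
  rw [tendsto_order]
  constructor
  · intro c hc
    obtain ⟨d, hd, hdL⟩ := exists_between (max_lt hc (by positivity : 0 < a * k / b))
    have hd0 : 0 < d := (le_max_right _ _).trans_lt hd
    have hδ : 0 < a * k / d - b := by
      rw [lt_div_iff₀ hb] at hdL
      rw [sub_pos, lt_div_iff₀ hd0]; linarith
    set x₀ := ((k + a) / q + 1) * q / (a * k / d - b) with hx₀
    have hx₀pos : 0 < x₀ := by positivity
    have hev : ∀ᶠ x in atTop, -(x * σ x) ≤ -d := by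
      refine eventually_le_of_deriv_le_neg_one (x₀ := x₀)
        (fun x hx => (hder x (hx₀pos.trans_le hx)).neg) (fun x hx hle => ?_)
      have hx0 : 0 < x := hx₀pos.trans_le hx
      have h1 : a * k / d * x ≤ a * k / σ x := by
        rw [div_mul_eq_mul_div, div_le_div_iff₀ hd0 (hσ x)]
        have : x * σ x ≤ d := by linarith
        have hak : 0 < a * k := by positivity
        nlinarith
      have h2 : ((k + a) / q + 1) * q ≤ (a * k / d - b) * x := by
        rw [ge_iff_le, hx₀, div_le_iff₀ hδ] at hx; linarith
      have h3 := h.upper x hx0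
      have h4 := hσ x
      have h5 : ((k + a) / q + 1) * q = k + a + q := by field_simp
      have h6 : (σ x - (k - a) - a * k / σ x + b * x) / q ≤ -1 := by
        rw [div_le_iff₀ hq]; linarith
      linarith
    filter_upwards [hev] with x hx
    exact ((le_max_left _ _).trans_lt hd).trans_le (by linarith)
  · intro c hc
    obtain ⟨d, hdL, hd⟩ := exists_between hc
    have hd0 : 0 < d := lt_trans (by positivity) hdL
    have hδ : 0 < b - a * k / d := by
      rw [div_lt_iff₀ hb] at hdL
      rw [sub_pos, div_lt_iff₀ hd0]; linarith
    set x₀ := (k * q + k + q) / (b - a * k / d) with hx₀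
    have hx₀pos : 0 < x₀ := by positivity
    have hev : ∀ᶠ x in atTop, x * σ x ≤ d := by
      refine eventually_le_of_deriv_le_neg_one (x₀ := x₀)
        (fun x hx => hder x (hx₀pos.trans_le hx)) (fun x hx hle => ?_)
      have hx0 : 0 < x := hx₀pos.trans_le hx
      have h1 : a * k / σ x ≤ a * k / d * x := by
        rw [div_mul_eq_mul_div, div_le_div_iff₀ (hσ x) hd0]
        have hak : 0 < a * k := by positivity
        nlinarith
      have h2 : k * q + k + q ≤ (b - a * k / d) * x := by
        rw [ge_iff_le, hx₀, div_le_iff₀ hδ] at hx; linarith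
      have h3 := h.upper x hx0
      have h4 := hσ x
      have h6 : k + 1 ≤ (σ x - (k - a) - a * k / σ x + b * x) / q := by
        rw [le_div_iff₀ hq]; linarith
      linarith
    filter_upwards [hev] with x hx
    linarith

end IsSlope

/-- The time `s` at which the orbit generated by the slope function `σ` has logarithmic amplitude
`t`: the primitive of `-1 / (q σ(e ^ t))`, normalized so that `k s + t / q → 0` as `t → -∞`. -/
noncomputable def clock (k q : ℝ) (σ : ℝ → ℝ) (t : ℝ) : ℝ :=
  -(1 / (k * q)) * (t + ∫ y in (0 : ℝ)..Real.exp t, (k / σ y - 1) / y)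

namespace IsSlope

variable {a k q b : ℝ} {σ : ℝ → ℝ}

lemma clock_integrand_nonneg (h : IsSlope a k q b σ) (ha : 0 < a) (hk : 0 < k) (hb : 0 < b)
    (y : ℝ) : 0 ≤ (k / σ y - 1) / y := by
  rcases le_or_gt y 0 with hy | hy
  · rw [h.eq_of_nonpos y hy, div_self hk.ne', sub_self, zero_div]
  · refine div_nonneg ?_ hy.le
    rw [sub_nonneg, le_div_iff₀ (h.pos ha hk hb y), one_mul]
    exact h.upper y hy

lemma clock_integrand_le (h : IsSlope a k q b σ) (ha : 0 < a) (hk : 0 < k) (hb : 0 < b)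
    (y : ℝ) : (k / σ y - 1) / y ≤ b / a := by
  rcases le_or_gt y 0 with hy | hy
  · rw [h.eq_of_nonpos y hy, div_self hk.ne', sub_self, zero_div]
    positivity
  · have h1 := h.lower y hy
    have hden : 0 < 1 + b / a * y := by positivity
    rw [div_le_iff₀ hy, sub_le_iff_le_add, div_le_iff₀ (h.pos ha hk hb y)]
    rw [div_le_iff₀ hden] at h1
    linarith

lemma measurable_clock_integrand (h : IsSlope a k q b σ) :
    Measurable (fun y => (k / σ y - 1) / y) := by
  have := h.measurable
  fun_prop

lemma clock_intervalIntegrable (h : IsSlope a k q b σ) (ha : 0 < a) (hk : 0 < k) (hb : 0 < b)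
    (x z : ℝ) : IntervalIntegrable (fun y => (k / σ y - 1) / y) MeasureTheory.volume x z := by
  refine (intervalIntegrable_const (c := b / a)).mono_fun
    h.measurable_clock_integrand.aestronglyMeasurable (Eventually.of_forall fun y => ?_)
  beta_reduce
  rw [Real.norm_of_nonneg (h.clock_integrand_nonneg ha hk hb y)]
  exact (h.clock_integrand_le ha hk hb y).trans (le_abs_self _)

lemma hasDerivAt_clock (h : IsSlope a k q b σ) (ha : 0 < a) (hk : 0 < k) (hq : 0 < q)
    (hb : 0 < b) (t : ℝ) : HasDerivAt (clock k q σ) (-(1 / (q * σ (Real.exp t)))) t := by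
  have hσ := h.pos ha hk hb (Real.exp t)
  have hc : ContinuousAt (fun y => (k / σ y - 1) / y) (Real.exp t) :=
    ((continuousAt_const.div (h.hasDerivAt _ (Real.exp_pos t)).continuousAt hσ.ne').sub
      continuousAt_const).div continuousAt_id (Real.exp_pos t).ne'
  have h1 := intervalIntegral.integral_hasDerivAt_right
    (h.clock_intervalIntegrable ha hk hb 0 (Real.exp t))
    (h.measurable_clock_integrand.stronglyMeasurable.stronglyMeasurableAtFilter) hc
  have h2 := (((hasDerivAt_id t).add (h1.comp t (Real.hasDerivAt_exp t))).const_mul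
    (-(1 / (k * q))))
  refine h2.congr_deriv ?_
  have := (Real.exp_pos t).ne'
  field_simp
  ring

lemma clock_eq (hk : 0 < k) (hq : 0 < q) (t : ℝ) :
    k * clock k q σ t + t / q
      = -(1 / q) * ∫ y in (0 : ℝ)..Real.exp t, (k / σ y - 1) / y := by
  unfold clock
  field_simp
  ring

lemma tendsto_clock_atBot (h : IsSlope a k q b σ) (ha : 0 < a) (hk : 0 < k) (hq : 0 < q)
    (hb : 0 < b) : Tendsto (fun t => k * clock k q σ t + t / q) atBot (𝓝 0) := by
  simp_rw [clock_eq hk hq]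
  have h1 : Continuous (fun x => ∫ y in (0 : ℝ)..x, (k / σ y - 1) / y) :=
    intervalIntegral.continuous_primitive (fun x z => h.clock_intervalIntegrable ha hk hb x z) 0
  have h2 := ((h1.tendsto 0).comp Real.tendsto_exp_atBot).const_mul (-(1 / q))
  simpa using h2

lemma clock_strictAnti (h : IsSlope a k q b σ) (ha : 0 < a) (hk : 0 < k) (hq : 0 < q)
    (hb : 0 < b) : StrictAnti (clock k q σ) := by
  refine strictAnti_of_deriv_neg fun t => ?_
  rw [(h.hasDerivAt_clock ha hk hq hb t).deriv]
  have := h.pos ha hk hb (Real.exp t)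
  rw [neg_lt_zero]
  positivity

lemma clock_surjective (h : IsSlope a k q b σ) (ha : 0 < a) (hk : 0 < k) (hq : 0 < q)
    (hb : 0 < b) : Function.Surjective (clock k q σ) := by
  have hc : Continuous (clock k q σ) :=
    continuous_iff_continuousAt.2 fun t => (h.hasDerivAt_clock ha hk hq hb t).continuousAt
  have hkq : 0 < 1 / (k * q) := by positivity
  refine hc.surjective' ?_ ?_
  · have h1 := h.tendsto_clock_atBot ha hk hq hb
    have h2 : Tendsto (fun t : ℝ => -(t / q)) atBot atTop :=
      tendsto_neg_atBot_atTop.comp (tendsto_id.atBot_div_const hq)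
    have h3 := ((h2.atTop_add h1).const_mul_atTop (by positivity : 0 < 1 / k))
    refine h3.congr fun t => ?_
    field_simp
    ring
  · have hle : ∀ t, clock k q σ t ≤ -(1 / (k * q)) * t := fun t => by
      have hI : 0 ≤ ∫ y in (0 : ℝ)..Real.exp t, (k / σ y - 1) / y :=
        intervalIntegral.integral_nonneg (Real.exp_pos t).le
          fun y _ => h.clock_integrand_nonneg ha hk hb y
      unfold clock
      nlinarith
    exact tendsto_atBot_mono hle (tendsto_id.const_mul_atTop_of_neg (neg_lt_zero.2 hkq))

end IsSlope

/-! ### Orbits of the autonomous system -/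

/-- `(T, ς)` solves, on all of `ℝ`, the planar system `T' = -q ς`,
`ς' = (ς - k) (ς + a) + b e ^ T ς`. -/
structure IsOrbit (a k q b : ℝ) (T ς : ℝ → ℝ) : Prop where
  hasDerivAt_left : ∀ s, HasDerivAt T (-q * ς s) s
  hasDerivAt_right : ∀ s,
    HasDerivAt ς ((ς s - k) * (ς s + a) + b * Real.exp (T s) * ς s) s

theorem exists_isOrbit {a k q b : ℝ} (ha : 0 < a) (hk : 0 < k) (hq : 0 < q) (hb : 0 < b)
    (l : ℝ) : ∃ T ς : ℝ → ℝ, IsOrbit a k q b T ς ∧ (∀ s, 0 < ς s) ∧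
      Tendsto (fun s => k * s + T s / q) atTop (𝓝 l) ∧
      Tendsto (fun s => Real.exp (T s) / (-s)) atBot (𝓝 (q * a * k / b)) := by
  obtain ⟨σ, h⟩ := exists_isSlope ha hk hq hb
  have hσ := h.pos ha hk hb
  have hmono : StrictMono (fun t => -clock k q σ t) := (h.clock_strictAnti ha hk hq hb).neg
  have hsurj : Function.Surjective (fun t => -clock k q σ t) := fun s => by
    obtain ⟨t, ht⟩ := h.clock_surjective ha hk hq hb (-s)
    exact ⟨t, by simp [ht]⟩
  set e : ℝ ≃o ℝ := StrictMono.orderIsoOfSurjective _ hmono hsurj with he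
  have hec : ∀ t, e t = -clock k q σ t := fun t => rfl
  set T : ℝ → ℝ := fun s => e.symm (l / k - s) with hT
  have hTc : Continuous T := e.symm.toHomeomorph.continuous.comp (by fun_prop)
  have hclock : ∀ s, clock k q σ (T s) = s - l / k := fun s => by
    have := e.apply_symm_apply (l / k - s)
    rw [hec] at this
    simp only [hT]
    linarith
  have hTder : ∀ s, HasDerivAt T (-q * σ (Real.exp (T s))) s := fun s => by
    have h0 := hσ (Real.exp (T s))
    have h1 : HasDerivAt (fun t => clock k q σ t + l / k) _ (T s) :=
      (h.hasDerivAt_clock ha hk hq hb (T s)).add_const (l / k)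
    refine (HasDerivAt.of_local_left_inverse hTc.continuousAt h1 ?_
      (Eventually.of_forall fun s => by rw [hclock]; ring)).congr_deriv ?_
    · have : 0 < 1 / (q * σ (Real.exp (T s))) := by positivity
      linarith
    · field_simp
  have hTop : Tendsto T atTop atBot :=
    e.symm.tendsto_atBot.comp (tendsto_atBot_add_const_left _ _ tendsto_neg_atTop_atBot)
  have hBot : Tendsto T atBot atTop :=
    e.symm.tendsto_atTop.comp (tendsto_atTop_add_const_left _ _ tendsto_neg_atBot_atTop)
  refine ⟨T, fun s => σ (Real.exp (T s)), ⟨hTder, fun s => ?_⟩, fun s => hσ _, ?_, ?_⟩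
  · have h0 := hσ (Real.exp (T s))
    refine ((h.hasDerivAt _ (Real.exp_pos (T s))).comp s
      ((Real.hasDerivAt_exp (T s)).comp s (hTder s))).congr_deriv ?_
    have := (Real.exp_pos (T s)).ne'
    field_simp
    ring
  · have h1 := ((h.tendsto_clock_atBot ha hk hq hb).comp hTop).add_const l
    rw [zero_add] at h1
    refine h1.congr fun s => ?_
    simp only [Function.comp, hclock]
    field_simp
    ring
  · -- In the variable `x = e ^ T` the elapsed time has derivative `-1 / (q x σ x)`, which
    -- converges because `x σ x` does.
    have h1 : Tendsto (fun x => -clock k q σ (Real.log x) / x) atTop (𝓝 (b / (q * a * k))) := by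
      refine tendsto_div_self_of_tendsto_deriv (φ' := fun x => 1 / (q * (x * σ x)))
        (fun x hx => ?_) ?_
      · refine (((h.hasDerivAt_clock ha hk hq hb (Real.log x)).comp x
          (Real.hasDerivAt_log hx.ne')).neg).congr_deriv ?_
        rw [Real.exp_log hx]
        have := hσ x
        field_simp
      · have h2 := ((h.tendsto_mul_self ha hk hq hb).const_mul q).inv₀ (by positivity)
        simp_rw [one_div]
        convert h2 using 2
        field_simp
    have h2 := h1.comp (Real.tendsto_exp_atTop.comp hBot)
    have h3 : Tendsto (fun s : ℝ => (l / k - s) / (-s)) atBot (𝓝 1) := by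
      have h4 : Tendsto (fun s : ℝ => 1 - l / k * s⁻¹) atBot (𝓝 (1 - l / k * 0)) :=
        tendsto_const_nhds.sub (tendsto_inv_atBot_zero.const_mul _)
      rw [mul_zero, sub_zero] at h4
      refine h4.congr' ?_
      filter_upwards [eventually_lt_atBot 0] with s hs
      have := hs.ne
      field_simp
      ring
    have h4 := h3.mul (h2.inv₀ (by positivity))
    rw [inv_div, one_mul] at h4
    refine h4.congr' ?_
    filter_upwards [eventually_lt_atBot 0, eventually_lt_atBot (l / k)] with s hs hs'
    have h5 : l / k - s ≠ 0 := by linarith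
    have h6 := hs.ne
    simp only [Function.comp, Real.log_exp, hclock, inv_div, neg_sub]
    rw [div_mul_div_comm, mul_comm (-s), mul_div_mul_left _ _ h5]

/-- Along an orbit with a finite decay rate, `ς` cannot be nonpositive: it would stay so, and
`k s + T / q` would grow at least like `k s`. -/
lemma IsOrbit.pos {a k q b l : ℝ} {T ς : ℝ → ℝ} (h : IsOrbit a k q b T ς) (ha : 0 < a)
    (hk : 0 < k) (hq : 0 < q) (hl : Tendsto (fun s => k * s + T s / q) atTop (𝓝 l)) (s₀ : ℝ) :
    0 < ς s₀ := by
  by_contra! hs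
  have h1 : ∀ s ≥ s₀, ς s ≤ 0 := fun s hs' =>
    le_const_of_deriv_neg_at_const (fun s _ => h.hasDerivAt_right s) hs
      (fun s _ h0 => by rw [h0]; have := mul_pos hk ha; linarith) hs'
  have hd : ∀ s, HasDerivAt (fun s => -(k * s + T s / q)) (-(k - ς s)) s := fun s => by
    refine ((((hasDerivAt_id s).const_mul k).add
      ((h.hasDerivAt_left s).div_const q)).neg).congr_deriv ?_
    field_simp
    ring
  have h2 : ∀ s ≥ s₀, k * (s - s₀) + (k * s₀ + T s₀ / q) ≤ k * s + T s / q := fun s hs' => by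
    have := sub_le_of_deriv_le_on_Ici (fun s _ => hd s) (C := -k)
      (fun s hs => by linarith [h1 s hs]) hs'
    linarith
  have h3 : Tendsto (fun s => k * (s - s₀) + (k * s₀ + T s₀ / q)) atTop atTop :=
    tendsto_atTop_add_const_right _ _
      ((tendsto_atTop_add_const_right _ (-s₀) tendsto_id).const_mul_atTop hk)
  exact not_tendsto_nhds_of_tendsto_atTop
    (tendsto_atTop_mono' _ ((eventually_ge_atTop s₀).mono h2) h3) l hl

/-- Along an orbit with a finite decay rate, `ς` stays below `k`: otherwise it would stay above
some constant larger than `k`, and `k s + T / q` would tend to `-∞`. -/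
lemma IsOrbit.lt {a k q b l : ℝ} {T ς : ℝ → ℝ} (h : IsOrbit a k q b T ς) (ha : 0 < a)
    (hk : 0 < k) (hq : 0 < q) (hb : 0 < b)
    (hl : Tendsto (fun s => k * s + T s / q) atTop (𝓝 l)) (s₀ : ℝ) : ς s₀ < k := by
  by_contra! hs
  have hneg : ∀ s, HasDerivAt (fun s => -ς s)
      (-((ς s - k) * (ς s + a) + b * Real.exp (T s) * ς s)) s := fun s => (h.hasDerivAt_right s).neg
  have h1 : ∀ s ≥ s₀, k ≤ ς s := fun s hs' => by
    have := le_const_of_deriv_neg_at_const (c := -k) (fun s _ => hneg s) (by linarith)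
      (fun s _ h0 => by
        have h0' : ς s = k := by linarith
        rw [h0', sub_self, zero_mul, zero_add, neg_lt_zero]
        positivity) hs'
    linarith
  have hpos : ∀ s ≥ s₀, 0 < (ς s - k) * (ς s + a) + b * Real.exp (T s) * ς s := fun s hs' => by
    have h2 := h1 s hs'
    have h3 : 0 ≤ (ς s - k) * (ς s + a) := mul_nonneg (by linarith) (by linarith)
    have h4 : 0 < b * Real.exp (T s) * ς s := by
      have : 0 < ς s := by linarith
      positivity
    linarith
  have hmono : StrictMonoOn ς (Ici s₀) :=
    strictMonoOn_of_deriv_pos (convex_Ici s₀)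
      (fun s _ => (h.hasDerivAt_right s).continuousAt.continuousWithinAt)
      (fun s hs' => by rw [(h.hasDerivAt_right s).deriv]; exact hpos s (interior_subset hs'))
  have h2 : k < ς (s₀ + 1) :=
    hs.trans_lt (hmono self_mem_Ici (show s₀ ≤ s₀ + 1 by linarith) (by linarith))
  have h3 : ∀ s ≥ s₀ + 1, ς (s₀ + 1) ≤ ς s := fun s hs' =>
    hmono.monotoneOn (show s₀ ≤ s₀ + 1 by linarith) (show s₀ ≤ s by linarith) hs'
  have hd : ∀ s, HasDerivAt (fun s => k * s + T s / q) (k - ς s) s := fun s => by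
    refine (((hasDerivAt_id s).const_mul k).add
      ((h.hasDerivAt_left s).div_const q)).congr_deriv ?_
    field_simp
    ring
  have h4 : ∀ s ≥ s₀ + 1, k * s + T s / q ≤
      (k - ς (s₀ + 1)) * (s + -(s₀ + 1)) + (k * (s₀ + 1) + T (s₀ + 1) / q) := fun s hs' => by
    have := sub_le_of_deriv_le_on_Ici (fun s _ => hd s) (C := k - ς (s₀ + 1))
      (fun s hs => by linarith [h3 s hs]) hs'
    linarith
  have h5 : Tendsto (fun s => (k - ς (s₀ + 1)) * (s + -(s₀ + 1)) +
      (k * (s₀ + 1) + T (s₀ + 1) / q)) atTop atBot :=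
    tendsto_atBot_add_const_right _ _
      ((tendsto_atTop_add_const_right _ (-(s₀ + 1)) tendsto_id).const_mul_atTop_of_neg
        (by linarith))
  exact not_tendsto_nhds_of_tendsto_atBot
    (tendsto_atBot_mono' _ ((eventually_ge_atTop _).mono h4) h5) l hl

/-- Every orbit with a finite decay rate lies on the graph of the slope function. The deviation
`R = ς - σ(e ^ T)` satisfies `R' = (ς + a k / σ(e ^ T)) R`, so `R ^ 2` has exponential growth unless
it vanishes; but `R` is bounded. -/
lemma IsOrbit.eq_slope {a k q b l : ℝ} {T ς σ : ℝ → ℝ} (h : IsOrbit a k q b T ς)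
    (hσ : IsSlope a k q b σ) (ha : 0 < a) (hk : 0 < k) (hq : 0 < q) (hb : 0 < b)
    (hl : Tendsto (fun s => k * s + T s / q) atTop (𝓝 l)) (s₀ : ℝ) :
    ς s₀ = σ (Real.exp (T s₀)) := by
  set R : ℝ → ℝ := fun s => ς s - σ (Real.exp (T s)) with hR
  have hςpos := h.pos ha hk hq hl
  have hςlt := h.lt ha hk hq hb hl
  have hσpos := hσ.pos ha hk hb
  have hRd : ∀ s, HasDerivAt R ((ς s + a * k / σ (Real.exp (T s))) * R s) s := fun s => by
    refine ((h.hasDerivAt_right s).sub ((hσ.hasDerivAt _ (Real.exp_pos (T s))).comp s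
      ((Real.hasDerivAt_exp (T s)).comp s (h.hasDerivAt_left s)))).congr_deriv ?_
    have := (Real.exp_pos (T s)).ne'
    have := (hσpos (Real.exp (T s))).ne'
    simp only [hR]
    field_simp
    ring
  have hRb : ∀ s, R s ^ 2 ≤ k ^ 2 := fun s => by
    have h1 := hσ.upper _ (Real.exp_pos (T s))
    have h2 := hσpos (Real.exp (T s))
    have h3 := hςpos s
    have h4 := hςlt s
    refine sq_le_sq' ?_ ?_ <;> simp only [hR] <;> linarith
  have hsq : ∀ s, HasDerivAt (fun s => R s ^ 2)
      (2 * (ς s + a * k / σ (Real.exp (T s))) * R s ^ 2) s := fun s => by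
    refine ((hRd s).pow 2).congr_deriv ?_
    push_cast
    ring
  have hrate : ∀ s, a ≤ ς s + a * k / σ (Real.exp (T s)) := fun s => by
    have h1 := hσ.upper _ (Real.exp_pos (T s))
    have h2 := hσpos (Real.exp (T s))
    have h3 : a ≤ a * k / σ (Real.exp (T s)) := by
      rw [le_div_iff₀ h2]; gcongr
    linarith [hςpos s]
  by_contra hne
  have hR0 : 0 < R s₀ ^ 2 := by
    have : R s₀ ≠ 0 := sub_ne_zero.2 hne
    positivity
  have hmono : Monotone (fun s => R s ^ 2) := by
    refine monotone_of_deriv_nonneg (fun s => (hsq s).differentiableAt) fun s => ?_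
    rw [(hsq s).deriv]
    have := hrate s
    have : 0 ≤ ς s + a * k / σ (Real.exp (T s)) := by linarith
    positivity
  -- Linear growth already contradicts boundedness.
  have hgrow : ∀ s ≥ s₀, 2 * a * R s₀ ^ 2 * (s - s₀) ≤ k ^ 2 := fun s hs => by
    have h1 := sub_le_of_deriv_le_on_Ici (fun s _ => (hsq s).neg) (C := -(2 * a * R s₀ ^ 2))
      (fun s hs => by
        have h2 : R s₀ ^ 2 ≤ R s ^ 2 := hmono hs
        have h3 := hrate s
        have h4 : a * R s₀ ^ 2 ≤ (ς s + a * k / σ (Real.exp (T s))) * R s ^ 2 :=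
          mul_le_mul h3 h2 hR0.le (by linarith)
        linarith) hs
    simp only [Pi.neg_apply] at h1
    linarith [hRb s]
  have hc : 0 < 2 * a * R s₀ ^ 2 := by positivity
  have h1 := hgrow (s₀ + (k ^ 2 + 1) / (2 * a * R s₀ ^ 2)) (by
    have : 0 < (k ^ 2 + 1) / (2 * a * R s₀ ^ 2) := by positivity
    linarith)
  rw [add_sub_cancel_left, mul_div_cancel₀ _ hc.ne'] at h1
  linarith

theorem IsOrbit.unique {a k q b l : ℝ} {T ς T₁ ς₁ : ℝ → ℝ} (h : IsOrbit a k q b T ς)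
    (h₁ : IsOrbit a k q b T₁ ς₁) (ha : 0 < a) (hk : 0 < k) (hq : 0 < q) (hb : 0 < b)
    (hl : Tendsto (fun s => k * s + T s / q) atTop (𝓝 l))
    (hl₁ : Tendsto (fun s => k * s + T₁ s / q) atTop (𝓝 l)) : T = T₁ := by
  obtain ⟨σ, hσ⟩ := exists_isSlope ha hk hq hb
  -- Along any such orbit the clock shows the time, up to a constant fixed by the decay.
  have key : ∀ {T ς : ℝ → ℝ}, IsOrbit a k q b T ς →
      Tendsto (fun s => k * s + T s / q) atTop (𝓝 l) →
      ∀ s, clock k q σ (T s) = s - l / k := by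
    intro T ς h hl
    have hd : ∀ s, HasDerivAt (fun s => clock k q σ (T s) - s) 0 s := fun s => by
      refine (((hσ.hasDerivAt_clock ha hk hq hb (T s)).comp s (h.hasDerivAt_left s)).sub
        (hasDerivAt_id s)).congr_deriv ?_
      rw [h.eq_slope hσ ha hk hq hb hl s]
      have := hσ.pos ha hk hb (Real.exp (T s))
      field_simp
      ring
    have hconst : ∀ s, clock k q σ (T s) - s = clock k q σ (T 0) - 0 := fun s =>
      is_const_of_deriv_eq_zero (fun s => (hd s).differentiableAt) (fun s => (hd s).deriv) s 0
    have hTop : Tendsto T atTop atBot := by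
      have h1 : Tendsto (fun s => q * (-k * s + (k * s + T s / q))) atTop atBot :=
        ((tendsto_id.const_mul_atTop_of_neg (by linarith : -k < 0)).atBot_add hl).const_mul_atBot hq
      refine h1.congr fun s => ?_
      field_simp
      ring
    have h2 := hl.sub ((hσ.tendsto_clock_atBot ha hk hq hb).comp hTop)
    have h3 : l - 0 = -k * (clock k q σ (T 0) - 0) := by
      refine tendsto_nhds_unique h2 (tendsto_const_nhds.congr fun s => ?_)
      rw [← hconst s]
      simp only [Function.comp]
      ring
    intro s
    have h4 := hconst s
    have h5 : l / k = -(clock k q σ (T 0) - 0) := by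
      rw [div_eq_iff hk.ne']; linarith
    linarith
  funext s
  exact (hσ.clock_strictAnti ha hk hq hb).injective ((key h hl s).trans (key h₁ hl₁ s).symm)

/-! ### Profiles in logarithmic variables -/

lemma hasDerivAt_exp_comp_log {L L₁ : ℝ → ℝ} (hL : ∀ s, HasDerivAt L (L₁ s) s) (c : ℝ)
    {r : ℝ} (hr : 0 < r) :
    HasDerivAt (fun r => Real.exp (c * L (Real.log r)))
      (c * (Real.exp (c * L (Real.log r)) * L₁ (Real.log r) / r)) r := by
  refine ((((hL (Real.log r)).comp r (Real.hasDerivAt_log hr.ne')).const_mul c).exp).congr_deriv ?_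
  simp only [Function.comp]
  field_simp

lemma deriv_of_eq_exp_comp_log {f L L₁ : ℝ → ℝ} (hf : ∀ r > 0, f r = Real.exp (L (Real.log r)))
    (hL : ∀ s, HasDerivAt L (L₁ s) s) {r : ℝ} (hr : 0 < r) :
    deriv f r = f r * L₁ (Real.log r) / r := by
  have he : f =ᶠ[𝓝 r] fun r => Real.exp (1 * L (Real.log r)) :=
    (eventually_gt_nhds hr).mono fun z hz => by simp only [hf z hz, one_mul]
  rw [he.deriv_eq, (hasDerivAt_exp_comp_log hL 1 hr).deriv, hf r hr]
  simp only [one_mul]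

/-- With `f = e ^ L` in the variable `log r`, the profile equation is the second equation of the
planar system for `T = 2 s + (1 - m) L` and `ς = -m L' - a = -T' / q`. -/
lemma profile_ode_iff {n m α β a k b : ℝ} {f L L₁ L₂ : ℝ → ℝ} (hn : n - 1 ≠ 0) (hm : m ≠ 0)
    (hm1 : 1 - m ≠ 0) (hα : α = 2 * β / (1 - m)) (ha : a = 2 * m / (1 - m))
    (hk : k = n - 2 - a) (hb : b = -β / (n - 1))
    (hf : ∀ r > 0, f r = Real.exp (L (Real.log r)))
    (hL : ∀ s, HasDerivAt L (L₁ s) s) (hL₁ : ∀ s, HasDerivAt L₁ (L₂ s) s) {r : ℝ} (hr : 0 < r) :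
    (n - 1) / m * (deriv (deriv (fun s : ℝ => f s ^ m)) r
        + (n - 1) / r * deriv (fun s : ℝ => f s ^ m) r) + α * f r + β * r * deriv f r = 0 ↔
      -m * L₂ (Real.log r) = (-m * L₁ (Real.log r) - a - k) * (-m * L₁ (Real.log r) - a + a)
        + b * Real.exp (2 * Real.log r + (1 - m) * L (Real.log r))
          * (-m * L₁ (Real.log r) - a) := by
  have hpow : ∀ r > 0, f r ^ m = Real.exp (m * L (Real.log r)) := fun r hr => by
    rw [hf r hr, ← Real.exp_mul, mul_comm]
  have hd1 : ∀ r > 0, deriv (fun s : ℝ => f s ^ m) r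
      = m * (Real.exp (m * L (Real.log r)) * L₁ (Real.log r) / r) := fun r hr => by
    have he : (fun s : ℝ => f s ^ m) =ᶠ[𝓝 r] fun r => Real.exp (m * L (Real.log r)) :=
      (eventually_gt_nhds hr).mono fun z hz => hpow z hz
    rw [he.deriv_eq, (hasDerivAt_exp_comp_log hL m hr).deriv]
  have hd2 : deriv (deriv (fun s : ℝ => f s ^ m)) r = m * Real.exp (m * L (Real.log r)) / r ^ 2
      * (m * L₁ (Real.log r) ^ 2 + L₂ (Real.log r) - L₁ (Real.log r)) := by
    have he : deriv (fun s : ℝ => f s ^ m) =ᶠ[𝓝 r] fun r =>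
        m * (Real.exp (m * L (Real.log r)) * L₁ (Real.log r) / r) :=
      (eventually_gt_nhds hr).mono fun z hz => hd1 z hz
    rw [he.deriv_eq]
    refine (((((hasDerivAt_exp_comp_log hL m hr).mul
      ((hL₁ (Real.log r)).comp r (Real.hasDerivAt_log hr.ne'))).div
      (hasDerivAt_id r) hr.ne').const_mul m).congr_deriv ?_).deriv
    simp only [Function.comp, id, Pi.mul_apply]
    field_simp
  have hexp : Real.exp (L (Real.log r)) = Real.exp (m * L (Real.log r)) / r ^ 2
      * Real.exp (2 * Real.log r + (1 - m) * L (Real.log r)) := by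
    rw [div_mul_eq_mul_div, ← Real.exp_add, eq_div_iff (by positivity)]
    have : r ^ 2 = Real.exp (2 * Real.log r) := by
      rw [two_mul, Real.exp_add, Real.exp_log hr, sq]
    rw [this, ← Real.exp_add]
    congr 1
    ring
  rw [deriv_of_eq_exp_comp_log hf hL hr, hd2, hd1 r hr, hf r hr, hexp, ← sub_eq_zero (a := -m * _)]
  have hE := (Real.exp_pos (m * L (Real.log r))).ne'
  set E := Real.exp (m * L (Real.log r))
  set G := Real.exp (2 * Real.log r + (1 - m) * L (Real.log r))
  set x := L₁ (Real.log r)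
  set y := L₂ (Real.log r)
  have key : (n - 1) / m * (m * E / r ^ 2 * (m * x ^ 2 + y - x) + (n - 1) / r * (m * (E * x / r)))
      + α * (E / r ^ 2 * G) + β * r * (E / r ^ 2 * G * x / r)
      = -((n - 1) * E / (m * r ^ 2)) *
        (-m * y - ((-m * x - a - k) * (-m * x - a + a) + b * G * (-m * x - a))) := by
    rw [hk, hb, hα, ha]
    field_simp
    ring
  rw [key, mul_eq_zero, or_iff_right]
  exact neg_ne_zero.2 (div_ne_zero (mul_ne_zero hn hE) (by positivity))

lemma hasDecay_iff {n : ℕ} {m a k q A : ℝ} {f L : ℝ → ℝ} (hm : 0 < m)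
    (hm1 : 1 - m ≠ 0) (ha : a = 2 * m / (1 - m)) (hk : k = n - 2 - a) (hq : q = (1 - m) / m)
    (hA : 0 < A) (hf : ∀ r > 0, f r = Real.exp (L (Real.log r))) :
    HasDecay n m A f ↔
      Tendsto (fun s => k * s + (2 * s + (1 - m) * L s) / q) atTop (𝓝 (m * Real.log A)) := by
  have hrep : ∀ r > 0, r ^ (((n : ℝ) - 2) / m) * f r = Real.exp
      ((k * Real.log r + (2 * Real.log r + (1 - m) * L (Real.log r)) / q) / m) := fun r hr => by
    rw [hf r hr, Real.rpow_def_of_pos hr, ← Real.exp_add, hk, hq, ha]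
    congr 1
    field_simp
    ring
  constructor
  · intro h
    have h1 := (((Real.continuousAt_log hA.ne').tendsto.comp h).comp
      Real.tendsto_exp_atTop).const_mul m
    refine h1.congr fun s => ?_
    simp only [Function.comp]
    rw [hrep _ (Real.exp_pos s), Real.log_exp, Real.log_exp, mul_div_cancel₀ _ hm.ne']
  · intro h
    have h1 := (Real.continuous_exp.tendsto _).comp
      ((h.comp Real.tendsto_log_atTop).div_const m)
    rw [mul_div_cancel_left₀ _ hm.ne', Real.exp_log hA] at h1
    refine h1.congr' ?_
    filter_upwards [eventually_gt_atTop 0] with r hr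
    simp only [Function.comp]
    rw [hrep r hr]

/-- A profile, written in logarithmic variables, is an orbit of the planar system. -/
lemma IsProfile.exists_isOrbit {n : ℕ} {m α β a k q b : ℝ} {g : ℝ → ℝ}
    (hg : IsProfile n m α β g) (hn : (n : ℝ) - 1 ≠ 0) (hm : m ≠ 0) (hm1 : 1 - m ≠ 0)
    (hα : α = 2 * β / (1 - m)) (ha : a = 2 * m / (1 - m)) (hk : k = n - 2 - a)
    (hq : q = (1 - m) / m) (hb : b = -β / (n - 1)) :
    ∃ L ς : ℝ → ℝ, (∀ r > 0, g r = Real.exp (L (Real.log r))) ∧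
      IsOrbit a k q b (fun s => 2 * s + (1 - m) * L s) ς := by
  have hpos := hg.pos
  have hd : ∀ r > 0, HasDerivAt g (deriv g r) r := fun r hr =>
    ((hg.contDiffOn.differentiableOn (by norm_num)).differentiableAt
      (Ioi_mem_nhds hr)).hasDerivAt
  have hd2 : ∀ r > 0, HasDerivAt (deriv g) (deriv (deriv g) r) r := fun r hr =>
    (((hg.contDiffOn.deriv_of_isOpen isOpen_Ioi (m := 1) (by norm_num)).differentiableOn
      (by norm_num)).differentiableAt (Ioi_mem_nhds hr)).hasDerivAt
  set L : ℝ → ℝ := fun s => Real.log (g (Real.exp s)) with hLdef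
  set L₁ : ℝ → ℝ := fun s => deriv g (Real.exp s) * Real.exp s / g (Real.exp s) with hL₁def
  have hL : ∀ s, HasDerivAt L (L₁ s) s := fun s =>
    ((hd _ (Real.exp_pos s)).comp s (Real.hasDerivAt_exp s)).log (hpos _ (Real.exp_pos s)).ne'
  have hL₁ : ∀ s, HasDerivAt L₁ (deriv L₁ s) s := fun s =>
    ((((hd2 _ (Real.exp_pos s)).comp s (Real.hasDerivAt_exp s)).mul (Real.hasDerivAt_exp s)).div
      ((hd _ (Real.exp_pos s)).comp s (Real.hasDerivAt_exp s))
      (hpos _ (Real.exp_pos s)).ne').differentiableAt.hasDerivAt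
  have hrep : ∀ r > 0, g r = Real.exp (L (Real.log r)) := fun r hr => by
    simp only [hLdef]
    rw [Real.exp_log hr, Real.exp_log (hpos r hr)]
  refine ⟨L, fun s => -m * L₁ s - a, hrep, fun s => ?_, fun s => ?_⟩
  · refine (((hasDerivAt_id s).const_mul 2).add ((hL s).const_mul (1 - m))).congr_deriv ?_
    rw [hq, ha]
    field_simp
    ring
  · have h1 := (profile_ode_iff hn hm hm1 hα ha hk hb hrep hL hL₁ (Real.exp_pos s)).1
      (hg.ode _ (Real.exp_pos s))
    rw [Real.log_exp] at h1
    exact (((hL₁ s).const_mul (-m)).sub_const a).congr_deriv h1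

lemma IsOrbit.contDiff {a k q b : ℝ} {T ς : ℝ → ℝ} (h : IsOrbit a k q b T ς) :
    ContDiff ℝ 2 T := by
  have hT : Differentiable ℝ T := fun s => (h.hasDerivAt_left s).differentiableAt
  have hς : Differentiable ℝ ς := fun s => (h.hasDerivAt_right s).differentiableAt
  have h1 : ContDiff ℝ 1 ς := by
    refine contDiff_one_iff_deriv.2 ⟨hς, ?_⟩
    have e : deriv ς = fun s => (ς s - k) * (ς s + a) + b * Real.exp (T s) * ς s :=
      funext fun s => (h.hasDerivAt_right s).deriv
    have := hT.continuous
    have := hς.continuous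
    rw [e]
    fun_prop
  rw [show (2 : WithTop ℕ∞) = 1 + 1 by norm_num, contDiff_succ_iff_deriv]
  refine ⟨hT, by simp, ?_⟩
  rw [show deriv T = fun s => -q * ς s from funext fun s => (h.hasDerivAt_left s).deriv]
  exact contDiff_const.mul h1

theorem theorem1p1 (n : ℕ) (hn : 3 ≤ n) (m α β : ℝ) (hm0 : 0 < m)
    (hm1 : m < ((n : ℝ) - 2) / (n : ℝ)) (hβ : β < 0) (hα : α = 2 * β / (1 - m))
    (A : ℝ) (hA : 0 < A) :
    ∃ f : ℝ → ℝ,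
      IsProfile n m α β f ∧ HasDecay n m A f ∧
      (∀ g : ℝ → ℝ, IsProfile n m α β g → HasDecay n m A g → EqOn g f (Ioi 0)) ∧
      Tendsto (fun r : ℝ => r ^ 2 * f r ^ (1 - m) / Real.log (1 / r)) (𝓝[>] 0)
        (𝓝 (2 * ((n : ℝ) - 1) * ((n : ℝ) - 2 - (n : ℝ) * m) / ((1 - m) * |β|))) ∧
      ∀ r : ℝ, 0 < r → 0 < α * f r + β * r * deriv f r := by
  have hn3 : (3 : ℝ) ≤ n := by exact_mod_cast hn
  have hn1 : 0 < (n : ℝ) - 1 := by linarith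
  have hnm : m * n < n - 2 := (lt_div_iff₀ (by linarith)).1 hm1
  have hm : 0 < 1 - m := by nlinarith
  obtain ⟨a, ha⟩ : ∃ a, a = 2 * m / (1 - m) := ⟨_, rfl⟩
  obtain ⟨k, hk⟩ : ∃ k, k = n - 2 - a := ⟨_, rfl⟩
  obtain ⟨q, hq⟩ : ∃ q, q = (1 - m) / m := ⟨_, rfl⟩
  obtain ⟨b, hb⟩ : ∃ b, b = -β / (n - 1) := ⟨_, rfl⟩
  have ha0 : 0 < a := by rw [ha]; positivity
  have hk0 : 0 < k := by
    rw [hk, ha, sub_pos, div_lt_iff₀ hm]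
    linarith
  have hq0 : 0 < q := by rw [hq]; positivity
  have hb0 : 0 < b := by rw [hb]; exact div_pos (by linarith) hn1
  obtain ⟨T, ς, hT, hς, hdec, hlim⟩ := exists_isOrbit ha0 hk0 hq0 hb0 (m * Real.log A)
  set L : ℝ → ℝ := fun s => (T s - 2 * s) / (1 - m) with hLdef
  set L₁ : ℝ → ℝ := fun s => -(ς s + a) / m with hL₁def
  have hTL : T = fun s => 2 * s + (1 - m) * L s := by
    funext s
    simp only [hLdef]
    field_simp
    ring
  have hL : ∀ s, HasDerivAt L (L₁ s) s := fun s => by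
    refine (((hT.hasDerivAt_left s).sub ((hasDerivAt_id s).const_mul 2)).div_const _).congr_deriv ?_
    simp only [hL₁def]
    rw [hq, ha]
    field_simp
    ring
  have hL₁ : ∀ s, HasDerivAt L₁ _ s := fun s =>
    (((hT.hasDerivAt_right s).add_const a).neg).div_const m
  have hLc : ContDiff ℝ 2 L := (hT.contDiff.sub (contDiff_const.mul contDiff_id)).div_const _
  have hf : ∀ r > 0, (fun r => Real.exp (L (Real.log r))) r = Real.exp (L (Real.log r)) :=
    fun _ _ => rfl
  have hsς : ∀ s, -m * L₁ s - a = ς s := fun s => by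
    simp only [hL₁def]
    field_simp
    ring
  refine ⟨fun r => Real.exp (L (Real.log r)), ⟨?_, fun r _ => Real.exp_pos _, fun r hr => ?_⟩,
    ?_, fun g hg hgd => ?_, ?_, fun r hr => ?_⟩
  · exact Real.contDiff_exp.comp_contDiffOn (hLc.comp_contDiffOn
      (Real.contDiffOn_log.mono fun r hr => (ne_of_gt hr : r ≠ 0)))
  · refine (profile_ode_iff hn1.ne' hm0.ne' hm.ne' hα ha hk hb hf hL hL₁ hr).2 ?_
    rw [hsς, ← congrFun hTL]
    field_simp
  · refine (hasDecay_iff hm0 hm.ne' ha hk hq hA hf).2 ?_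
    rwa [hTL] at hdec
  · obtain ⟨Lg, ςg, hgrep, horb⟩ :=
      hg.exists_isOrbit hn1.ne' hm0.ne' hm.ne' hα ha hk hq hb
    have heq := horb.unique hT ha0 hk0 hq0 hb0 ((hasDecay_iff hm0 hm.ne' ha hk hq hA hgrep).1 hgd)
      hdec
    intro r hr
    have h1 := congrFun heq (Real.log r)
    rw [hTL] at h1
    have h2 : Lg (Real.log r) = L (Real.log r) :=
      mul_left_cancel₀ hm.ne' (add_left_cancel h1)
    simp only [hgrep r hr, h2]
  · have h1 := hlim.comp Real.tendsto_log_nhdsGT_zero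
    have hc : 2 * ((n : ℝ) - 1) * ((n : ℝ) - 2 - (n : ℝ) * m) / ((1 - m) * |β|)
        = q * a * k / b := by
      rw [abs_of_neg hβ, hk, hb, hq, ha]
      have := hβ.ne
      field_simp
      ring
    rw [hc]
    refine h1.congr' ?_
    filter_upwards [self_mem_nhdsWithin] with r hr
    have hr0 : 0 < r := hr
    have h2 : r ^ 2 = Real.exp (2 * Real.log r) := by
      rw [two_mul, Real.exp_add, Real.exp_log hr0, sq]
    simp only [Function.comp]
    rw [one_div, Real.log_inv, h2, ← Real.exp_mul, ← Real.exp_add, hTL, mul_comm (L _)]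
  · rw [deriv_of_eq_exp_comp_log hf hL hr]
    have h1 : α * Real.exp (L (Real.log r))
        + β * r * (Real.exp (L (Real.log r)) * L₁ (Real.log r) / r)
        = -β / m * Real.exp (L (Real.log r)) * ς (Real.log r) := by
      rw [← hsς, hα, ha]
      field_simp
      ring
    have h2 := hς (Real.log r)
    have h3 : 0 < -β / m := div_pos (by linarith) hm0
    simp only [h1]
    positivity
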